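/- For $n \ge 0$ let $\Gamma_n^* \subseteq \mathbb{R}^{2^n}$ be the set of entropic vectors, i.e. of the vectors $(H(X_\alpha))_{\alpha \subseteq [n]}$, where $(X_1,\dots,X_n)$ ranges over all jointly distributed tuples of random variables with finite domains, $X_\alpha = (X_i)_{i \in \alpha}$, and $H(Y) = -\sum_y \Pr[Y=y] \log_2 \Pr[Y=y]$ (with $0\log_2 0=0$). A vector is almost entropic if it lies in the topological closure $\overline{\Gamma_n^*}$. The almost-entropic-recognizability problem is the following decision problem: given a number $n$ and three families of positive integers $(a_\alpha)_{\alpha \subseteq [n]}$, $(b_\alpha)_{\alpha \subseteq [n]}$, $(c_\alpha)_{\alpha \subseteq [n]}$, decide whether the vector $h \in \mathbb{R}^{2^n}$ with $$h(\alpha) = \frac{1}{c_\alpha} \log_2 \frac{a_\alpha}{b_\alpha} \qquad (\alpha \subseteq [n])$$ is almost entropic. **Theorem.** The almost-entropic-recognizability problem is in $\Pi^0_2$. That is, the set of (codes of) inputs for which $h \in \overline{\Gamma_n^*}$ has the form $\{x \mid \forall y \in \mathbb{N}\ \exists z \in \mathbb{N}\ R(x,y,z)\}$ for some decidable relation $R$.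 -/

import Mathlib

/-- `p` is in `Π⁰₂`: it has the form `∀ y, ∃ z, R x y z` with `y`, `z` natural numbers and `R` a
decidable relation. -/
def IsPi02 {α : Type*} [Primcodable α] (p : α → Prop) : Prop :=
  ∃ R : α → ℕ → ℕ → Prop,
    ComputablePred (fun t : α × ℕ × ℕ => R t.1 t.2.1 t.2.2) ∧ ∀ x, p x ↔ ∀ y, ∃ z, R x y z

/-- The joint distribution of `n` random variables, the `i`-th one with values in the finite
domain `Fin (card i)`. -/
structure JointDist (n : ℕ) where
  card : Fin n → ℕ
  prob : (∀ i, Fin (card i)) → ℝ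
  prob_nonneg : ∀ x, 0 ≤ prob x
  prob_sum : ∑ x, prob x = 1

/-- The binary entropy `-∑ p(x) log₂ p(x)`; here `0 * logb 2 0 = 0`, as usual. -/
noncomputable def binaryEntropy {D : Type*} [Fintype D] (p : D → ℝ) : ℝ :=
  -∑ x, p x * Real.logb 2 (p x)

namespace JointDist

/-- The probability mass function of the random vector `(X_i : i ∈ s)`. -/
noncomputable def marginal {n : ℕ} (P : JointDist n) (s : Finset (Fin n))
    (y : ∀ i : s, Fin (P.card i)) : ℝ :=
  ∑ x with (∀ i : s, x i = y i), P.prob x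

/-- The entropic vector `s ↦ H(X_i : i ∈ s)`, with one coordinate for each set of variables. -/
noncomputable def entropyVector {n : ℕ} (P : JointDist n) : Finset (Fin n) → ℝ :=
  fun s => binaryEntropy (P.marginal s)

end JointDist

/-- The set `Γ*_n` of entropic vectors. -/
def entropicVectors (n : ℕ) : Set (Finset (Fin n) → ℝ) :=
  {h | ∃ P : JointDist n, h = P.entropyVector}

/-- The set of almost-entropic vectors, the topological closure of `Γ*_n` in `ℝ^(2^n)`. -/
def almostEntropicVectors (n : ℕ) : Set (Finset (Fin n) → ℝ) :=
  closure (entropicVectors n)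

/-- An input of the recognizability problem: the number `n` of variables and three families of
positive integers indexed by the sets of variables. -/
structure RecognizabilityInput where
  n : ℕ
  a : Finset (Fin n) → ℕ
  b : Finset (Fin n) → ℕ
  c : Finset (Fin n) → ℕ
  a_pos : ∀ s, 0 < a s
  b_pos : ∀ s, 0 < b s
  c_pos : ∀ s, 0 < c s

/-- The subset of `Fin n` whose characteristic vector is the binary expansion of `k`. -/
def subsetOfIndex (n k : ℕ) : Finset (Fin n) :=
  {i | k.testBit i = true}

namespace RecognizabilityInput

/-- The vector `h` that the input represents. -/
noncomputable def vector (I : RecognizabilityInput) : Finset (Fin I.n) → ℝ :=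
  fun s => 1 / (I.c s : ℝ) * Real.logb 2 ((I.a s : ℝ) / (I.b s : ℝ))

/-- The finite presentation of an input: `n` and the list of the `2 ^ n` triples `(a_s, b_s, c_s)`,
the sets `s` being listed in the binary order. -/
def code (I : RecognizabilityInput) : ℕ × List (ℕ × ℕ × ℕ) :=
  (I.n, (List.range (2 ^ I.n)).map fun k =>
    (I.a (subsetOfIndex I.n k), I.b (subsetOfIndex I.n k), I.c (subsetOfIndex I.n k)))

end RecognizabilityInput

theorem exists_subsetOfIndex {n : ℕ} (s : Finset (Fin n)) :
    ∃ k < 2 ^ n, subsetOfIndex n k = s := by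
  refine ⟨Nat.ofBits fun i : Fin n => decide (i ∈ s), Nat.ofBits_lt_two_pow _, ?_⟩
  ext i
  simp [subsetOfIndex, Nat.testBit_ofBits_lt]

/-- Different inputs have different codes. -/
theorem RecognizabilityInput.code_injective : Function.Injective RecognizabilityInput.code := by
  rintro ⟨n, a, b, c, ha, hb, hc⟩ ⟨n', a', b', c', ha', hb', hc'⟩ h
  obtain rfl : n = n' := congrArg Prod.fst h
  have h2 := congrArg Prod.snd h
  simp only [code, List.map_inj_left, List.mem_range, Prod.mk.injEq] at h2
  have key : ∀ s, a s = a' s ∧ b s = b' s ∧ c s = c' s := by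
    intro s
    obtain ⟨k, hk, rfl⟩ := exists_subsetOfIndex s
    exact h2 k hk
  obtain rfl : a = a' := funext fun s => (key s).1
  obtain rfl : b = b' := funext fun s => (key s).2.1
  obtain rfl : c = c' := funext fun s => (key s).2.2
  rfl

/-- The almost-entropic-recognizability problem, as the set of the codes of its yes-instances. -/
def AlmostEntropicRecognizable (w : ℕ × List (ℕ × ℕ × ℕ)) : Prop :=
  ∃ I : RecognizabilityInput, I.code = w ∧ I.vector ∈ almostEntropicVectors I.n

/-! Entropy is continuous and every distribution is a limit of empirical distributions of finite
sample tables (`JointDist.exists_empirical_near`). Hence `h` is almost entropic iff for each `y`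
some table has entropy vector within `1 / (y + 1)` of `h` in the sup metric
(`vector_mem_almostEntropicVectors_iff`). A table is a list of lists of naturals, so one number `z`
encodes it.

It remains to decide closeness. For `N` samples the entropy of a marginal is `log₂ N - (log₂ m) /
N`, where `m` is the product over the samples of their agreement counts (`binaryEntropy_empirical`).
As `h` also consists of rational multiples of logarithms of rationals, clearing denominators and
exponentiating leaves strict inequalities between naturals (`entropyClose_iff`), so no real
arithmetic has to be approximated. -/

open Filter Topology

/-- The samples `u` and `v` agree on the variables in the set with index `k`. -/
def SamplesAgree (n k : ℕ) (u v : List ℕ) : Prop :=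
  ∀ i ∈ List.range n, k.testBit i = true → u.getD i 0 = v.getD i 0

instance (n k : ℕ) (u v : List ℕ) : Decidable (SamplesAgree n k u v) := by
  unfold SamplesAgree; infer_instance

/-- The number of samples in `L` that agree with `u` on the set with index `k`. -/
def agreeCount (n k : ℕ) (L : List (List ℕ)) (u : List ℕ) : ℕ :=
  (L.filter fun v => decide (SamplesAgree n k v u)).length

/-- The product over the samples `u` in `L` of the number of samples that agree with `u`. -/
def agreeProd (n k : ℕ) (L : List (List ℕ)) : ℕ :=
  (L.map (agreeCount n k L)).foldr (· * ·) 1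

/-- With `N` samples and the product `m` of the agreement counts, `log₂ N - (log₂ m) / N` differs
from `(log₂ (a / b)) / c` by less than `1 / (y + 1)`, expressed by natural numbers. -/
def EntropyClose (y N m : ℕ) (t : ℕ × ℕ × ℕ) : Prop :=
  N ^ (N * ((y + 1) * t.2.2)) * t.2.1 ^ (N * (y + 1)) <
      2 ^ (N * t.2.2) * (m ^ ((y + 1) * t.2.2) * t.1 ^ (N * (y + 1))) ∧
    m ^ ((y + 1) * t.2.2) * t.1 ^ (N * (y + 1)) <
      2 ^ (N * t.2.2) * (N ^ (N * ((y + 1) * t.2.2)) * t.2.1 ^ (N * (y + 1)))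

/-- `w` is the code of an input. -/
def IsInputCode (w : ℕ × List (ℕ × ℕ × ℕ)) : Prop :=
  w.2.length = 2 ^ w.1 ∧ ∀ t ∈ w.2, 0 < t.1 ∧ 0 < t.2.1 ∧ 0 < t.2.2

/-- `L` is a nonempty list of samples with entropies `1 / (y + 1)`-close to those given by `w`. -/
def SamplesClose (w : ℕ × List (ℕ × ℕ × ℕ)) (y : ℕ) (L : List (List ℕ)) : Prop :=
  0 < L.length ∧ ∀ k ∈ List.range (2 ^ w.1),
    EntropyClose y L.length (agreeProd w.1 k L) (w.2.getD k (1, 1, 1))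

/-! ### Primitive recursiveness of the matrix -/

section Computability

open Primrec

theorem primrec_nat_pow : Primrec₂ ((· ^ ·) : ℕ → ℕ → ℕ) :=
  Primrec₂.unpaired'.1 Nat.Primrec.pow

theorem primrec_testBit : Primrec₂ Nat.testBit := by
  refine (Primrec.eq.decide.comp₂ (nat_mod.comp₂
    (nat_div.comp₂ Primrec₂.left (primrec_nat_pow.comp₂ (Primrec₂.const 2) Primrec₂.right))
    (Primrec₂.const 2)) (Primrec₂.const 1)).of_eq fun m i => ?_
  rw [Nat.testBit_eq_decide_div_mod_eq]

theorem primrecPred_imp {α : Type*} [Primcodable α] {p q : α → Prop} (hp : PrimrecPred p)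
    (hq : PrimrecPred q) : PrimrecPred fun a => p a → q a :=
  (hp.not.or hq).of_eq fun _ => imp_iff_not_or.symm

theorem primrecRel_samplesAgree :
    PrimrecRel fun (v : List ℕ) (x : (ℕ × ℕ) × List ℕ) => SamplesAgree x.1.1 x.1.2 v x.2 := by
  have h : PrimrecRel fun (i : ℕ) (x : List ℕ × ((ℕ × ℕ) × List ℕ)) =>
      x.2.1.2.testBit i = true → x.1.getD i 0 = x.2.2.getD i 0 := by
    refine primrecPred_imp (Primrec.eq.comp (primrec_testBit.comp
      (snd.comp <| fst.comp <| snd.comp snd) fst) (const true)) (Primrec.eq.comp ?_ ?_)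
    · exact (list_getD 0).comp (fst.comp snd) fst
    · exact (list_getD 0).comp (snd.comp <| snd.comp snd) fst
  exact h.forall_mem_list.comp (list_range.comp (fst.comp <| fst.comp snd)) Primrec.id

theorem primrec_agreeCount :
    Primrec₂ fun (x : (ℕ × ℕ) × List (List ℕ)) (u : List ℕ) => agreeCount x.1.1 x.1.2 x.2 u :=
  list_length.comp (primrecRel_samplesAgree.listFilter.comp (snd.comp fst)
    (Primrec.pair (fst.comp fst) snd))

theorem primrec_agreeProd :
    Primrec fun x : (ℕ × ℕ) × List (List ℕ) => agreeProd x.1.1 x.1.2 x.2 :=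
  list_foldr (list_map snd primrec_agreeCount) (const 1)
    (nat_mul.comp (fst.comp snd) (snd.comp snd)).to₂

theorem primrecPred_entropyClose :
    PrimrecPred fun x : (ℕ × ℕ × ℕ) × (ℕ × ℕ × ℕ) => EntropyClose x.1.1 x.1.2.1 x.1.2.2 x.2 := by
  have hy : Primrec fun x : (ℕ × ℕ × ℕ) × (ℕ × ℕ × ℕ) => x.1.1 + 1 := succ.comp (fst.comp fst)
  have hN : Primrec fun x : (ℕ × ℕ × ℕ) × (ℕ × ℕ × ℕ) => x.1.2.1 :=
    fst.comp (snd.comp fst)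
  have hm : Primrec fun x : (ℕ × ℕ × ℕ) × (ℕ × ℕ × ℕ) => x.1.2.2 :=
    snd.comp (snd.comp fst)
  have ha : Primrec fun x : (ℕ × ℕ × ℕ) × (ℕ × ℕ × ℕ) => x.2.1 := fst.comp snd
  have hb : Primrec fun x : (ℕ × ℕ × ℕ) × (ℕ × ℕ × ℕ) => x.2.2.1 := fst.comp (snd.comp snd)
  have hc : Primrec fun x : (ℕ × ℕ × ℕ) × (ℕ × ℕ × ℕ) => x.2.2.2 := snd.comp (snd.comp snd)
  have hyc := nat_mul.comp hy hc
  have hl := nat_mul.comp (primrec_nat_pow.comp hN (nat_mul.comp hN hyc))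
    (primrec_nat_pow.comp hb (nat_mul.comp hN hy))
  have hr := nat_mul.comp (primrec_nat_pow.comp hm hyc)
    (primrec_nat_pow.comp ha (nat_mul.comp hN hy))
  have h2 := primrec_nat_pow.comp (const 2) (nat_mul.comp hN hc)
  exact (nat_lt.comp hl (nat_mul.comp h2 hr)).and (nat_lt.comp hr (nat_mul.comp h2 hl))

theorem primrecPred_isInputCode : PrimrecPred IsInputCode := by
  have h : PrimrecPred fun t : ℕ × ℕ × ℕ => 0 < t.1 ∧ 0 < t.2.1 ∧ 0 < t.2.2 :=
    (nat_lt.comp (const 0) fst).and <| (nat_lt.comp (const 0) (fst.comp snd)).and <|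
      nat_lt.comp (const 0) (snd.comp snd)
  exact (Primrec.eq.comp (list_length.comp snd) (primrec_nat_pow.comp (const 2) fst)).and
    (h.forall_mem_list.comp snd)

theorem primrecPred_samplesClose :
    PrimrecPred fun x : (ℕ × List (ℕ × ℕ × ℕ)) × ℕ × List (List ℕ) =>
      SamplesClose x.1 x.2.1 x.2.2 := by
  have h : PrimrecRel fun (k : ℕ) (x : (ℕ × List (ℕ × ℕ × ℕ)) × ℕ × List (List ℕ)) =>
      EntropyClose x.2.1 x.2.2.length (agreeProd x.1.1 k x.2.2) (x.1.2.getD k (1, 1, 1)) := by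
    have hL : Primrec fun p : ℕ × ((ℕ × List (ℕ × ℕ × ℕ)) × ℕ × List (List ℕ)) => p.2.2.2 :=
      snd.comp (snd.comp snd)
    refine primrecPred_entropyClose.comp (Primrec.pair (Primrec.pair
      (fst.comp <| snd.comp snd) (Primrec.pair (list_length.comp hL) ?_)) ?_)
    · exact primrec_agreeProd.comp (Primrec.pair (Primrec.pair
        (fst.comp <| fst.comp snd) fst) hL)
    · exact (list_getD _).comp (snd.comp <| fst.comp snd) fst
  exact (nat_lt.comp (const 0) (list_length.comp (snd.comp snd))).and
    (h.forall_mem_list.comp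
      (list_range.comp (primrec_nat_pow.comp (const 2) (fst.comp fst))) Primrec.id)

theorem computablePred_samplesClose :
    ComputablePred fun x : (ℕ × List (ℕ × ℕ × ℕ)) × ℕ × ℕ =>
      IsInputCode x.1 ∧
        SamplesClose x.1 x.2.1 ((Encodable.decode (α := List (List ℕ)) x.2.2).getD []) :=
  ((primrecPred_isInputCode.comp fst).and <| primrecPred_samplesClose.comp <|
    Primrec.pair fst <| Primrec.pair (fst.comp snd) <|
      option_getD.comp (Primrec.decode.comp (snd.comp snd)) (const [])).computablePred

end Computability

/-! ### Valid codes and inputs -/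

theorem isInputCode_code (I : RecognizabilityInput) : IsInputCode I.code := by
  refine ⟨by simp [RecognizabilityInput.code], fun t ht => ?_⟩
  simp only [RecognizabilityInput.code, List.mem_map] at ht
  obtain ⟨k, -, rfl⟩ := ht
  exact ⟨I.a_pos _, I.b_pos _, I.c_pos _⟩

theorem RecognizabilityInput.code_getD (I : RecognizabilityInput) {k : ℕ} (hk : k < 2 ^ I.n) :
    I.code.2.getD k (1, 1, 1) = (I.a (subsetOfIndex I.n k), I.b (subsetOfIndex I.n k),
      I.c (subsetOfIndex I.n k)) := by
  simp [RecognizabilityInput.code, hk]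

theorem ofBits_mem_subsetOfIndex {n k : ℕ} (hk : k < 2 ^ n) :
    Nat.ofBits (fun i : Fin n => decide (i ∈ subsetOfIndex n k)) = k := by
  refine Nat.eq_of_testBit_eq fun i => ?_
  by_cases hi : i < n
  · simp [Nat.testBit_ofBits_lt _ _ hi, subsetOfIndex]
  · rw [Nat.testBit_ofBits_ge _ _ (not_lt.1 hi), Nat.testBit_lt_two_pow]
    exact hk.trans_le (Nat.pow_le_pow_right two_pos (not_lt.1 hi))

theorem exists_code_eq {w : ℕ × List (ℕ × ℕ × ℕ)} (hw : IsInputCode w) :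
    ∃ I : RecognizabilityInput, I.code = w := by
  obtain ⟨n, l⟩ := w
  obtain ⟨hl, hpos⟩ := hw
  let t : Finset (Fin n) → ℕ × ℕ × ℕ := fun s =>
    l.getD (Nat.ofBits fun i : Fin n => decide (i ∈ s)) (1, 1, 1)
  have ht : ∀ s, t s ∈ l := fun s => by
    have h := Nat.ofBits_lt_two_pow fun i : Fin n => decide (i ∈ s)
    rw [← hl] at h
    simp only [t, List.getD_eq_getElem _ _ h]
    exact List.getElem_mem h
  refine ⟨⟨n, fun s => (t s).1, fun s => (t s).2.1, fun s => (t s).2.2,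
    fun s => (hpos _ (ht s)).1, fun s => (hpos _ (ht s)).2.1, fun s => (hpos _ (ht s)).2.2⟩, ?_⟩
  simp only [RecognizabilityInput.code, Prod.mk.injEq, true_and]
  refine List.ext_getElem (by simpa using hl.symm) fun k hk hk' => ?_
  simp only [List.length_map, List.length_range] at hk
  simp only [List.getElem_map, List.getElem_range, t, ofBits_mem_subsetOfIndex hk]
  exact List.getD_eq_getElem _ _ hk'

/-- Multiplying the real inequality by `N * c * (y + 1)` makes all coefficients of the logarithms
integers and the bound `N * c`; the two sides of the absolute value are the two conjuncts of
`EntropyClose`. -/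
theorem entropyClose_iff {y N m a b c : ℕ} (hN : 0 < N) (hm : 0 < m) (ha : 0 < a) (hb : 0 < b)
    (hc : 0 < c) :
    EntropyClose y N m (a, b, c) ↔
      |Real.logb 2 N - 1 / (N : ℝ) * Real.logb 2 m - 1 / (c : ℝ) * Real.logb 2 ((a : ℝ) / b)| <
        1 / ((y : ℝ) + 1) := by
  have lt_iff : ∀ u v : ℕ, 0 < u → 0 < v → (u < v ↔ Real.logb 2 u < Real.logb 2 v) := by
    intro u v hu hv
    rw [Real.logb_lt_logb_iff one_lt_two (by positivity) (by positivity), Nat.cast_lt]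
  have logl : Real.logb 2 ((N ^ (N * ((y + 1) * c)) * b ^ (N * (y + 1)) : ℕ) : ℝ) =
      N * ((y + 1) * c) * Real.logb 2 N + N * (y + 1) * Real.logb 2 b := by
    push_cast
    rw [Real.logb_mul (by positivity) (by positivity), Real.logb_pow, Real.logb_pow]
    push_cast; ring
  have logr : Real.logb 2 ((m ^ ((y + 1) * c) * a ^ (N * (y + 1)) : ℕ) : ℝ) =
      (y + 1) * c * Real.logb 2 m + N * (y + 1) * Real.logb 2 a := by
    push_cast
    rw [Real.logb_mul (by positivity) (by positivity), Real.logb_pow, Real.logb_pow]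
    push_cast; ring
  have log2 : ∀ u : ℕ, 0 < u →
      Real.logb 2 ((2 ^ (N * c) * u : ℕ) : ℝ) = N * c + Real.logb 2 u := by
    intro u hu
    push_cast
    rw [Real.logb_mul (by positivity) (by positivity), Real.logb_pow, Real.logb_self_eq_one one_lt_two]
    push_cast; ring
  simp only [EntropyClose]
  rw [lt_iff _ _ (by positivity) (by positivity), lt_iff _ _ (by positivity) (by positivity),
    log2 _ (by positivity), log2 _ (by positivity), logl, logr,
    Real.logb_div (by positivity) (by positivity), abs_lt]
  have hK : (0 : ℝ) < N * c * (y + 1) := by positivity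
  set lN := Real.logb 2 N
  set lm := Real.logb 2 m
  set la := Real.logb 2 a
  set lb := Real.logb 2 b
  have hD : (lN - 1 / (N : ℝ) * lm - 1 / (c : ℝ) * (la - lb)) * (N * c * (y + 1)) =
      N * ((y + 1) * c) * lN + N * (y + 1) * lb - ((y + 1) * c * lm + N * (y + 1) * la) := by
    field_simp
    ring
  have h1 : 1 / ((y : ℝ) + 1) * (N * c * (y + 1)) = N * c := by
    field_simp
  rw [← mul_lt_mul_iff_left₀ hK (b := -(1 / ((y : ℝ) + 1))),
    ← mul_lt_mul_iff_left₀ hK (c := 1 / ((y : ℝ) + 1)), hD, neg_mul, h1]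
  constructor <;> rintro ⟨h, h'⟩ <;> constructor <;> linarith

/-! ### Empirical distributions and their density -/

/-- The entropy of the empirical distribution of the values of a finite family `r`. -/
theorem binaryEntropy_empirical {ι D : Type*} [Fintype ι] [Nonempty ι] [Fintype D] [DecidableEq D]
    (r : ι → D) :
    binaryEntropy (fun d => (Finset.card {j | r j = d} : ℝ) / Fintype.card ι) =
      Real.logb 2 (Fintype.card ι) -
        1 / (Fintype.card ι : ℝ) * ∑ j, Real.logb 2 (Finset.card {j' | r j' = r j}) := by
  have hN : (0 : ℝ) < Fintype.card ι := by exact_mod_cast Fintype.card_pos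
  have hcard : ∀ j, (0 : ℝ) < (Finset.card {j' | r j' = r j} : ℝ) := fun j => by
    exact_mod_cast Finset.card_pos.2 ⟨j, by simp⟩
  -- The term of a value `d` is spread evenly over the samples taking that value, so the sum over
  -- values becomes a sum over samples; unattained values contribute `0`.
  have key : ∀ d, (Finset.card {j | r j = d} : ℝ) / Fintype.card ι *
      Real.logb 2 ((Finset.card {j | r j = d} : ℝ) / Fintype.card ι) =
      ∑ j with r j = d, 1 / (Fintype.card ι : ℝ) *
        (Real.logb 2 (Finset.card {j' | r j' = r j}) - Real.logb 2 (Fintype.card ι)) := by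
    intro d
    rw [Finset.sum_congr rfl (g := fun _ => 1 / (Fintype.card ι : ℝ) *
      Real.logb 2 ((Finset.card {j | r j = d} : ℝ) / Fintype.card ι))]
    · rw [Finset.sum_const, nsmul_eq_mul]; ring
    · intro j hj
      obtain rfl := (Finset.mem_filter.1 hj).2
      rw [Real.logb_div (hcard j).ne' hN.ne']
  rw [binaryEntropy, Finset.sum_congr rfl fun d _ => key d, Finset.sum_fiberwise,
    ← Finset.mul_sum, Finset.sum_sub_distrib, Finset.sum_const, nsmul_eq_mul, Finset.card_univ]
  field_simp
  ring

namespace JointDist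

/-- The empirical distribution of a finite family of samples. -/
noncomputable def empirical {ι : Type*} [Fintype ι] [Nonempty ι] {n : ℕ} (card : Fin n → ℕ)
    (f : ι → ∀ i, Fin (card i)) : JointDist n where
  card := card
  prob x := (Finset.card {j | f j = x} : ℝ) / Fintype.card ι
  prob_nonneg x := by positivity
  prob_sum := by
    rw [← Finset.sum_div, div_eq_one_iff_eq (by simp), ← Nat.cast_sum,
      ← Finset.card_eq_sum_card_fiberwise (fun _ _ => Finset.mem_coe.2 (Finset.mem_univ _)),
      Finset.card_univ]

theorem empirical_marginal {ι : Type*} [Fintype ι] [Nonempty ι] {n : ℕ} (card : Fin n → ℕ)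
    (f : ι → ∀ i, Fin (card i)) (s : Finset (Fin n)) :
    (empirical card f).marginal s = fun y : ∀ i : s, Fin (card i) =>
      (Finset.card {j | (fun i : s => f j i) = y} : ℝ) / Fintype.card ι := by
  funext (y : ∀ i : s, Fin (card i))
  simp only [marginal, empirical]
  rw [← Finset.sum_div, ← Nat.cast_sum]
  congr 2
  rw [Finset.card_eq_sum_card_fiberwise (f := f)
    (t := {x : ∀ i, Fin (card i) | ∀ i : s, x i = y i})]
  · refine Finset.sum_congr rfl fun x hx => ?_
    congr 1
    ext j
    simp only [Finset.mem_filter, Finset.mem_univ, true_and] at hx ⊢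
    refine ⟨fun h => ⟨funext fun i => by rw [h]; exact hx i, h⟩, fun h => h.2⟩
  · intro j hj
    simp only [Finset.coe_filter, Finset.mem_univ, true_and, Set.mem_ofPred_eq] at hj ⊢
    exact fun i => congrFun hj i

theorem empirical_entropyVector {ι : Type*} [Fintype ι] [Nonempty ι] {n : ℕ} (card : Fin n → ℕ)
    (f : ι → ∀ i, Fin (card i)) (s : Finset (Fin n)) :
    (empirical card f).entropyVector s = Real.logb 2 (Fintype.card ι) -
      1 / (Fintype.card ι : ℝ) *
        ∑ j, Real.logb 2 (Finset.card {j' | ∀ i ∈ s, f j' i = f j i}) := by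
  rw [entropyVector, empirical_marginal]
  refine (binaryEntropy_empirical fun j => fun i : s => f j i).trans ?_
  simp only [funext_iff, Subtype.forall]

/-- Continuity of `t * log t` includes `t = 0`, so vanishing probabilities need no separate
treatment. -/
theorem continuous_binaryEntropy_marginal {n : ℕ} (card : Fin n → ℕ) (s : Finset (Fin n)) :
    Continuous fun p : (∀ i, Fin (card i)) → ℝ =>
      binaryEntropy fun y : ∀ i : s, Fin (card i) => ∑ x with (∀ i : s, x i = y i), p x := by
  have h : Continuous fun t : ℝ => t * Real.logb 2 t := by
    simp only [Real.logb, ← mul_div_assoc]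
    exact Real.continuous_mul_log.div_const _
  unfold binaryEntropy
  refine (continuous_finsetSum _ fun y _ => ?_).neg
  exact h.comp (continuous_finsetSum _ fun x _ => continuous_apply x)

/-- Empirical distributions of samples are dense. -/
theorem exists_empirical_near {n : ℕ} (P : JointDist n) {ε : ℝ} (hε : 0 < ε) :
    ∃ (N : ℕ) (_ : NeZero N) (f : Fin N → ∀ i, Fin (P.card i)),
      dist (empirical P.card f).entropyVector P.entropyVector < ε := by
  -- The value `x` is to be repeated `m N x` times. Rounding down may lose mass, so the table has `T
  -- N` rows instead of `N`, with `T N / N → 1`.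
  let m : ℕ → (∀ i, Fin (P.card i)) → ℕ := fun N x => ⌊P.prob x * N⌋₊
  let T : ℕ → ℕ := fun N => ∑ x, m N x
  have hm : ∀ x, Tendsto (fun N : ℕ => (m N x : ℝ) / N) atTop (𝓝 (P.prob x)) := fun x =>
    (tendsto_nat_floor_mul_div_atTop (P.prob_nonneg x)).comp tendsto_natCast_atTop_atTop
  have hT : Tendsto (fun N : ℕ => (T N : ℝ) / N) atTop (𝓝 1) := by
    rw [← P.prob_sum]
    refine (tendsto_finsetSum _ fun x _ => hm x).congr fun N => ?_
    rw [← Finset.sum_div, ← Nat.cast_sum]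
  have hq : Tendsto (fun (N : ℕ) x => (m N x : ℝ) / T N) atTop (𝓝 P.prob) := by
    refine tendsto_pi_nhds.2 fun x => ?_
    have h := (hm x).div hT one_ne_zero
    rw [div_one] at h
    refine h.congr' ?_
    filter_upwards [eventually_gt_atTop 0] with N hN
    have : (N : ℝ) ≠ 0 := by positivity
    exact div_div_div_cancel_right₀ this _ _
  have hent : Tendsto (fun (N : ℕ) (s : Finset (Fin n)) =>
      binaryEntropy fun y : ∀ i : s, Fin (P.card i) =>
        ∑ x with (∀ i : s, x i = y i), (m N x : ℝ) / T N) atTop (𝓝 P.entropyVector) :=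
    tendsto_pi_nhds.2 fun s =>
      ((continuous_binaryEntropy_marginal P.card s).tendsto P.prob).comp hq
  obtain ⟨N, hN, hpos⟩ := ((hent.eventually (Metric.ball_mem_nhds _ hε)).and
    (hT.eventually (lt_mem_nhds one_pos))).exists
  have hTN : T N ≠ 0 := fun h => by simp [h] at hpos
  let e : (Σ x, Fin (m N x)) ≃ Fin (T N) := Fintype.equivFinOfCardEq (by simp [T])
  refine ⟨T N, ⟨hTN⟩, fun j => (e.symm j).1, ?_⟩
  have : NeZero (T N) := ⟨hTN⟩
  convert hN using 2
  have hprob : ∀ x : ∀ i, Fin (P.card i), (empirical P.card fun j => (e.symm j).1).prob x = (m N x : ℝ) / T N := by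
    intro x
    simp only [empirical, Fintype.card_fin]
    congr 2
    have : ({j | (e.symm j).1 = x} : Finset (Fin (T N))) =
        Finset.univ.map ((Function.Embedding.sigmaMk x).trans e.toEmbedding) := by
      ext j
      obtain ⟨⟨x', k⟩, rfl⟩ := e.surjective j
      simp only [Finset.mem_filter, Finset.mem_univ, true_and, Equiv.symm_apply_apply,
        Finset.mem_map, Function.Embedding.trans_apply, Function.Embedding.sigmaMk_apply,
        Equiv.coe_toEmbedding, EmbeddingLike.apply_eq_iff_eq]
      constructor
      · rintro rfl; exact ⟨k, rfl⟩
      · rintro ⟨k', h⟩; exact (congrArg Sigma.fst h).symm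
    rw [this]
    simp
  funext s
  simp only [entropyVector]
  congr 1
  funext y
  exact Finset.sum_congr rfl fun x _ => hprob x

end JointDist

/-! ### Sample lists versus empirical distributions -/

theorem agreeCount_map {ι : Type*} [Fintype ι] {n : ℕ} {card : Fin n → ℕ}
    {f : ι → ∀ i, Fin (card i)} {g : ι → List ℕ} (hg : ∀ j (i : Fin _), (g j).getD i 0 = f j i)
    {l : List ι} (hl : l.Nodup) (hmem : ∀ j, j ∈ l) (k : ℕ) (j : ι) :
    agreeCount n k (l.map g) (g j) =
      Finset.card {j' | ∀ i ∈ subsetOfIndex n k, f j' i = f j i} := by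
  classical
  have hagree : ∀ j', SamplesAgree n k (g j') (g j) ↔
      ∀ i ∈ subsetOfIndex n k, f j' i = f j i := by
    intro j'
    simp only [SamplesAgree, List.mem_range, subsetOfIndex, Finset.mem_filter, Finset.mem_univ,
      true_and]
    refine ⟨fun h i hi => Fin.ext ?_, fun h i hin hi => ?_⟩
    · rw [← hg, ← hg]; exact h i i.2 hi
    · have := hg j' ⟨i, hin⟩
      have h2 := hg j ⟨i, hin⟩
      simp only at this h2
      rw [this, h2, h ⟨i, hin⟩ hi]
  rw [agreeCount, List.filter_map, List.length_map, ← List.toFinset_card_of_nodup (hl.filter _)]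
  congr 1
  ext j'
  simp [hmem, hagree]

theorem agreeProd_map {ι : Type*} [Fintype ι] {n : ℕ} {card : Fin n → ℕ}
    {f : ι → ∀ i, Fin (card i)} {g : ι → List ℕ} (hg : ∀ j (i : Fin _), (g j).getD i 0 = f j i)
    {l : List ι} (hl : l.Nodup) (hmem : ∀ j, j ∈ l) (k : ℕ) :
    agreeProd n k (l.map g) =
      ∏ j, Finset.card {j' | ∀ i ∈ subsetOfIndex n k, f j' i = f j i} := by
  classical
  rw [agreeProd, ← List.prod_eq_foldr, List.map_map,
    show (Finset.univ : Finset ι) = l.toFinset by ext; simp [hmem], List.prod_toFinset _ hl]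
  congr 1
  refine List.map_congr_left fun j _ => ?_
  exact (agreeCount_map hg hl hmem k j).trans (by congr; ext; simp [hmem])

/-- The bridge between the arithmetic test and the metric, used in both directions: to read a
distribution off a list and to list the samples of a distribution. The sup metric lets it be checked
one subset at a time. -/
theorem samplesClose_map_iff (I : RecognizabilityInput) {ι : Type*} [Fintype ι] [Nonempty ι]
    {card : Fin I.n → ℕ} {f : ι → ∀ i, Fin (card i)} {g : ι → List ℕ}
    (hg : ∀ j (i : Fin _), (g j).getD i 0 = f j i) {l : List ι} (hl : l.Nodup) (hmem : ∀ j, j ∈ l)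
    (y : ℕ) :
    SamplesClose I.code y (l.map g) ↔
      dist (JointDist.empirical card f).entropyVector I.vector < 1 / ((y : ℝ) + 1) := by
  classical
  have hlen : l.length = Fintype.card ι := by
    rw [← List.toFinset_card_of_nodup hl, ← Finset.card_univ]
    congr 1
    ext; simp [hmem]
  have hcard : ∀ s : Finset (Fin I.n), ∀ j,
      0 < Finset.card {j' | ∀ i ∈ s, f j' i = f j i} := fun s j =>
    Finset.card_pos.2 ⟨j, by simp⟩
  have key : ∀ k < 2 ^ I.n, (EntropyClose y (l.map g).length (agreeProd I.n k (l.map g))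
      (I.code.2.getD k (1, 1, 1)) ↔
      dist ((JointDist.empirical card f).entropyVector (subsetOfIndex I.n k))
        (I.vector (subsetOfIndex I.n k)) < 1 / ((y : ℝ) + 1)) := by
    intro k hk
    rw [I.code_getD hk, agreeProd_map hg hl hmem, List.length_map, hlen,
      entropyClose_iff Fintype.card_pos (Finset.prod_pos fun j _ => hcard _ j)
        (I.a_pos _) (I.b_pos _) (I.c_pos _), JointDist.empirical_entropyVector, Real.dist_eq,
      RecognizabilityInput.vector, Nat.cast_prod,
      Real.logb_prod _ _ fun j _ => Nat.cast_ne_zero.2 (hcard _ j).ne']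
  have hlpos : 0 < (l.map g).length := by
    rw [List.length_map, hlen]; exact Fintype.card_pos
  rw [dist_pi_lt_iff (by positivity)]
  constructor
  · rintro ⟨-, h⟩ s
    obtain ⟨k, hk, rfl⟩ := exists_subsetOfIndex s
    exact (key k hk).1 (h k (List.mem_range.2 hk))
  · exact fun h => ⟨hlpos, fun k hk => (key k (List.mem_range.1 hk)).2 (h _)⟩

theorem exists_dist_lt_of_samplesClose {I : RecognizabilityInput} {y : ℕ} {L : List (List ℕ)}
    (h : SamplesClose I.code y L) :
    ∃ v ∈ entropicVectors I.n, dist v I.vector < 1 / ((y : ℝ) + 1) := by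
  have : NeZero L.length := ⟨h.1.ne'⟩
  -- Any bound above all entries of column `i` would do. Rows that are too short are padded by `0`,
  -- so every nonempty list is a legitimate table.
  let card : Fin I.n → ℕ := fun i => ∑ j : Fin L.length, (L.get j).getD i 0 + 1
  let f : Fin L.length → ∀ i, Fin (card i) := fun j i => ⟨(L.get j).getD i 0,
    Nat.lt_succ_of_le <| Finset.single_le_sum (f := fun j : Fin L.length => (L.get j).getD i 0)
      (fun _ _ => Nat.zero_le _) (Finset.mem_univ j)⟩
  refine ⟨_, ⟨JointDist.empirical card f, rfl⟩, ?_⟩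
  refine (samplesClose_map_iff I (g := L.get) (fun j i => rfl) (List.nodup_finRange _)
    List.mem_finRange y).1 ?_
  rwa [List.map_get_finRange]

theorem exists_samplesClose {I : RecognizabilityInput} {P : JointDist I.n} {y : ℕ}
    (h : dist P.entropyVector I.vector < 1 / ((y : ℝ) + 1)) :
    ∃ L, SamplesClose I.code y L := by
  obtain ⟨N, _, f, hf⟩ := P.exists_empirical_near (sub_pos.2 h)
  refine ⟨_, (samplesClose_map_iff I (f := f) (g := fun j => List.ofFn fun i => (f j i : ℕ))
    (fun j i => by simp) (List.nodup_finRange _) List.mem_finRange y).2 ?_⟩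
  linarith [dist_triangle (JointDist.empirical P.card f).entropyVector P.entropyVector I.vector]

theorem vector_mem_almostEntropicVectors_iff (I : RecognizabilityInput) :
    I.vector ∈ almostEntropicVectors I.n ↔ ∀ y, ∃ L, SamplesClose I.code y L := by
  rw [almostEntropicVectors, Metric.mem_closure_iff]
  constructor
  · intro h y
    obtain ⟨_, ⟨P, rfl⟩, hP⟩ := h (1 / ((y : ℝ) + 1)) (by positivity)
    exact exists_samplesClose (by rwa [dist_comm])
  · intro h ε hε
    obtain ⟨y, hy⟩ := exists_nat_one_div_lt hε
    obtain ⟨L, hL⟩ := h y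
    obtain ⟨v, hv, hd⟩ := exists_dist_lt_of_samplesClose hL
    exact ⟨v, hv, by rw [dist_comm]; exact hd.trans hy⟩

theorem mainTheorem10 : IsPi02 AlmostEntropicRecognizable := by
  refine ⟨fun w y z => IsInputCode w ∧
    SamplesClose w y ((Encodable.decode (α := List (List ℕ)) z).getD []),
    computablePred_samplesClose, fun w => ⟨?_, fun h => ?_⟩⟩
  · rintro ⟨I, rfl, hI⟩ y
    obtain ⟨L, hL⟩ := (vector_mem_almostEntropicVectors_iff I).1 hI y
    exact ⟨Encodable.encode L, isInputCode_code I, by simpa using hL⟩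
  -- Validity of the code does not depend on `y`, so one instance yields the input `I`.
  · obtain ⟨z, hw, -⟩ := h 0
    obtain ⟨I, rfl⟩ := exists_code_eq hw
    refine ⟨I, rfl, (vector_mem_almostEntropicVectors_iff I).2 fun y => ?_⟩
    obtain ⟨z, -, hz⟩ := h y
    exact ⟨_, hz⟩
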